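/- A tessellation of $\mathbb{R}^2$ is a locally finite covering of $\mathbb{R}^2$ by countably many compact convex polygons (its cells) with nonempty, pairwise disjoint interiors. A random tessellation $T=\{\Xi_n\}_{n\in\mathbb N}$ is a sequence of random polygons $\Xi_n$ all of whose realisations are tessellations; its edge set is the random closed set $T^{(1)}=\bigcup_n\partial\Xi_n$. Let $\mathcal F$ be the family of closed subsets of $\mathbb{R}^2$ and let $\mathcal B(\mathcal F)$ be the $\sigma$-algebra generated by the sets $\{F\in\mathcal F: F\cap C\neq\emptyset\}$ with $C\subset\mathbb{R}^2$ compact. $T$ is called stationary if $T^{(1)}+x$ has the same distribution as $T^{(1)}$ for every $x\in\mathbb{R}^2$. $T$ is called mixing if it is stationary and $$\lim_{|x|\to\infty}\mathbb{P}\bigl(T^{(1)}\in A,\;T^{(1)}+x\in A'\bigr)=\mathbb{P}\bigl(T^{(1)}\in A\bigr)\,\mathbb{P}\bigl(T^{(1)}\in A'\bigr)\qquad\text{for all }A,A'\in\mathcal B(\mathcal F).$$ A superposition of two independent random tessellations $T_I$ and $T_{II}$ is a random tessellation $T$ with edge set $T^{(1)}=T_I^{(1)}\cup T_{II}^{(1)}$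 almost surely. A nesting with initial tessellation $T_I=\{\Xi_n\}$ and component tessellation $T_{II}$ is a random tessellation $T$ obtained by subdividing each cell $\Xi_n$ of $T_I$ by $T_{II,n}$, where $T_{II,1},T_{II,2},\dots$ are independent copies of $T_{II}$ that are independent of $T_I$; that is, almost surely $T^{(1)}=\bigcup_n\bigl(\partial\Xi_n\cup(\Xi_n\cap T_{II,n}^{(1)})\bigr)$. Then the following holds. 1. If $T$ is a superposition of two independent mixing random tessellations $T_I$ and $T_{II}$, then $T$ is mixing. 2. If $T$ is a nesting with a mixing initial tessellation $T_I$ and any stationary component tessellation $T_{II}$, then $T$ is mixing. -/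

import Mathlib

namespace RandTess

open MeasureTheory ProbabilityTheory Filter Topology TopologicalSpace

/-- The Euclidean plane. -/
abbrev Plane : Type := EuclideanSpace ℝ (Fin 2)

/-- The σ-algebra on the family of closed subsets of the plane that is generated by the hitting
sets `{F | F ∩ C ≠ ∅}`, `C` compact. -/
instance closedsMeasurableSpace : MeasurableSpace (Closeds Plane) :=
  MeasurableSpace.generateFrom
    {S | ∃ C : Set Plane, IsCompact C ∧ S = {F : Closeds Plane | ((F : Set Plane) ∩ C).Nonempty}}

/-- The translate `F + x` of a closed set `F`. -/
def translate (x : Plane) (F : Closeds Plane) : Closeds Plane where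
  carrier := (fun y => y + x) '' (F : Set Plane)
  isClosed' := (Homeomorph.addRight x).isClosedMap _ F.isClosed

/-- A sequence of subsets of the plane is a tessellation if it is a locally finite covering of the
plane by (compact, convex) polygons with nonempty and pairwise disjoint interiors. Infinitely many
cells are needed to cover the plane, so indexing the cells by `ℕ` is no restriction. -/
structure IsTessellation (Ξ : ℕ → Set Plane) : Prop where
  polygon : ∀ n, ∃ V : Set Plane, V.Finite ∧ Ξ n = convexHull ℝ V
  interior_nonempty : ∀ n, (interior (Ξ n)).Nonempty
  interior_disjoint : ∀ m n, m ≠ n → Disjoint (interior (Ξ m)) (interior (Ξ n))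
  cover : ⋃ n, Ξ n = Set.univ
  locallyFinite : LocallyFinite Ξ

/-- A random tessellation `{Ξ_n}`: a sequence of random polygons, each of whose realisations is a
tessellation of the plane. -/
structure RandomTessellation (Ω : Type*) [MeasurableSpace Ω] where
  cell : ℕ → Ω → Closeds Plane
  measurable_cell : ∀ n, Measurable (cell n)
  isTessellation : ∀ ω, IsTessellation (fun n => (cell n ω : Set Plane))

/-- The edge set `T⁽¹⁾ = ⋃ n, ∂Ξ_n`. -/
def RandomTessellation.edgeSet {Ω : Type*} [MeasurableSpace Ω] (T : RandomTessellation Ω)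
    (ω : Ω) : Closeds Plane where
  carrier := ⋃ n, frontier (T.cell n ω : Set Plane)
  isClosed' := ((T.isTessellation ω).locallyFinite.subset
    fun n => (T.cell n ω).isClosed.frontier_subset).isClosed_iUnion fun _ => isClosed_frontier

/-- `T` is stationary: `T⁽¹⁾ + x` and `T⁽¹⁾` have the same distribution for every `x`. -/
def RandomTessellation.IsStationary {Ω : Type*} [MeasurableSpace Ω] (T : RandomTessellation Ω)
    (P : Measure Ω) : Prop :=
  ∀ x : Plane, IdentDistrib (fun ω => translate x (T.edgeSet ω)) T.edgeSet P P

/-- `T` is mixing: it is stationary, and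
`P(T⁽¹⁾ ∈ A, T⁽¹⁾ + x ∈ A') → P(T⁽¹⁾ ∈ A) P(T⁽¹⁾ ∈ A')` as `|x| → ∞`, for all measurable families
`A`, `A'` of closed sets. -/
def RandomTessellation.IsMixing {Ω : Type*} [MeasurableSpace Ω] (T : RandomTessellation Ω)
    (P : Measure Ω) : Prop :=
  T.IsStationary P ∧
    ∀ A A' : Set (Closeds Plane), MeasurableSet A → MeasurableSet A' →
      Tendsto (fun x : Plane => P.real {ω | T.edgeSet ω ∈ A ∧ translate x (T.edgeSet ω) ∈ A'})
        (Bornology.cobounded Plane)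
        (𝓝 (P.real {ω | T.edgeSet ω ∈ A} * P.real {ω | T.edgeSet ω ∈ A'}))

/-- `T` is a superposition of `T₁` and `T₂`: these are independent, and the edge set of `T` is
(almost surely) the union of their edge sets. -/
def IsSuperposition {Ω : Type*} [MeasurableSpace Ω] (P : Measure Ω)
    (T T₁ T₂ : RandomTessellation Ω) : Prop :=
  IndepFun T₁.edgeSet T₂.edgeSet P ∧
    ∀ᵐ ω ∂P, (T.edgeSet ω : Set Plane) = (T₁.edgeSet ω : Set Plane) ∪ T₂.edgeSet ω

/-- `T` is a nesting with initial tessellation `T₁ = {Ξ_n}` and component tessellation `T₂`: there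
are independent copies `S 0, S 1, …` of `T₂`, jointly independent of the sequence of the cells of
`T₁`, such that `T` arises by subdividing every cell `Ξ_n` by `S n`, that is, the edge set of `T` is
(almost surely) the union over `n` of `∂Ξ_n` and of the part of the edge set of `S n` in `Ξ_n`.
The component tessellation only enters through its distribution, so it may live on another
probability space. -/
def IsNesting {Ω Ω' : Type*} [MeasurableSpace Ω] [MeasurableSpace Ω'] (P : Measure Ω)
    (P' : Measure Ω') (T T₁ : RandomTessellation Ω) (T₂ : RandomTessellation Ω') : Prop :=
  ∃ S : ℕ → RandomTessellation Ω,
    (∀ n, IdentDistrib (S n).edgeSet T₂.edgeSet P P') ∧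
    iIndepFun (fun n => (S n).edgeSet) P ∧
    IndepFun (fun ω n => T₁.cell n ω) (fun ω n => (S n).edgeSet ω) P ∧
    ∀ᵐ ω ∂P, (T.edgeSet ω : Set Plane) =
      ⋃ n, frontier (T₁.cell n ω : Set Plane) ∪
        ((T₁.cell n ω : Set Plane) ∩ (S n).edgeSet ω)

end RandTess

/-!
The families of closed sets that miss a given compact set `C` form a generating π-system, so
stationarity and mixing of an edge set only have to be checked on its void probabilities
`P(T⁽¹⁾ ∩ C = ∅)`. For stationarity this is uniqueness of measures; for mixing it holds because,
with one of the two events fixed, the joint probabilities are measures dominated by the law of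
`T⁽¹⁾`, and limits of such measures respect countable disjoint unions
(`tendsto_mixing_of_missing`). The event "`T⁽¹⁾` misses `C` and `T⁽¹⁾ + x` misses `C'`" is itself
the event that `T⁽¹⁾` misses `C ∪ (C' - x)`.

For a superposition the void probabilities, and thus their limits, multiply
(`IsSuperposition.isMixing`).

For a nesting let `q` be the void probability functional of the component tessellation.
Conditioning on the cells `Ξ n` of the initial tessellation gives
`P(T⁽¹⁾ ∩ C = ∅) = E[∏ n, q (Ξ n ∩ C)]`, where the product is replaced by `0` if an edge of the
initial tessellation meets `C` (`IsNesting.real_missing`). The hypotheses on the initial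
tessellation concern its edge set only, so this product must be seen to be a measurable function
`G C` of the edge set: the cells are convex, so two points lie in the same open cell if and only if
the segment between them misses the edges, and countably many such events determine how `C` is cut
by the cells (`exists_measurable_eq_cellProd`). Stationarity of the component tessellation yields
`G (C' - x) F = G C' (F + x)`. For large `x` no cell meets both `C` and `C' - x`, and then
`G (C ∪ (C' - x)) F = G C F * G C' (F + x)`; mixing of the initial tessellation, extended from
events to `[0, 1]`-valued functions by the layer-cake formula (`tendsto_integral_mul_translate`),
concludes the proof (`IsNesting.isMixing`).
-/

namespace RandTess

open MeasureTheory ProbabilityTheory Filter Topology TopologicalSpace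

/-! ### Families of closed sets that miss a compact set -/

/-- The family of closed sets that do not meet `C`. -/
def missing (C : Set Plane) : Set (Closeds Plane) := {F | Disjoint (F : Set Plane) C}

lemma mem_missing {C : Set Plane} {F : Closeds Plane} :
    F ∈ missing C ↔ Disjoint (F : Set Plane) C := Iff.rfl

lemma measurableSet_missing {C : Set Plane} (hC : IsCompact C) : MeasurableSet (missing C) := by
  have h : MeasurableSet {F : Closeds Plane | ((F : Set Plane) ∩ C).Nonempty} :=
    MeasurableSpace.measurableSet_generateFrom ⟨C, hC, rfl⟩
  convert h.compl using 1
  ext F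
  simp [missing, Set.not_nonempty_iff_eq_empty, Set.disjoint_iff_inter_eq_empty]

lemma missing_inter (C C' : Set Plane) : missing C ∩ missing C' = missing (C ∪ C') := by
  ext F
  simp [missing]

lemma missing_empty : missing ∅ = Set.univ := by
  ext F
  simp [missing]

/-- The families `missing C` with `C` compact. -/
def missingSets : Set (Set (Closeds Plane)) := {S | ∃ C, IsCompact C ∧ S = missing C}

lemma isPiSystem_missingSets : IsPiSystem missingSets := by
  rintro _ ⟨C, hC, rfl⟩ _ ⟨C', hC', rfl⟩ -
  exact ⟨C ∪ C', hC.union hC', missing_inter C C'⟩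

lemma generateFrom_missingSets :
    closedsMeasurableSpace = MeasurableSpace.generateFrom missingSets := by
  apply le_antisymm
  · refine MeasurableSpace.generateFrom_le ?_
    rintro _ ⟨C, hC, rfl⟩
    have h : MeasurableSet[MeasurableSpace.generateFrom missingSets] (missing C) :=
      MeasurableSpace.measurableSet_generateFrom ⟨C, hC, rfl⟩
    convert h.compl using 1
    ext F
    simp [missing, Set.not_disjoint_iff_nonempty_inter]
  · refine MeasurableSpace.generateFrom_le ?_
    rintro _ ⟨C, hC, rfl⟩
    exact measurableSet_missing hC

lemma measurable_of_missing {α : Type*} [MeasurableSpace α] {Z : α → Closeds Plane}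
    (h : ∀ C, IsCompact C → MeasurableSet (Z ⁻¹' missing C)) : Measurable Z := by
  rw [generateFrom_missingSets]
  refine measurable_generateFrom ?_
  rintro _ ⟨C, hC, rfl⟩
  exact h C hC

lemma coe_translate (x : Plane) (F : Closeds Plane) :
    (translate x F : Set Plane) = (fun y => y + x) '' (F : Set Plane) := rfl

lemma translate_mem_missing {x : Plane} {F : Closeds Plane} {C : Set Plane} :
    translate x F ∈ missing C ↔ F ∈ missing ((fun y => y + x) ⁻¹' C) := by
  rw [mem_missing, mem_missing, coe_translate, Set.disjoint_image_left]

lemma isCompact_preimage_add {C : Set Plane} (hC : IsCompact C) (x : Plane) :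
    IsCompact ((fun y => y + x) ⁻¹' C) :=
  (Homeomorph.addRight x).isCompact_preimage.2 hC

lemma measurable_translate (x : Plane) : Measurable (translate x) := by
  refine measurable_of_missing fun C hC => ?_
  convert measurableSet_missing (isCompact_preimage_add hC x) using 1
  ext F
  exact translate_mem_missing

/-- The closed balls of radius `1 / (k + 1)` about the points of a dense sequence. -/
def ratBall (p : ℕ × ℕ) : Set Plane :=
  Metric.closedBall (denseSeq Plane p.1) (1 / (p.2 + 1))

lemma isCompact_ratBall (p : ℕ × ℕ) : IsCompact (ratBall p) := isCompact_closedBall _ _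

lemma exists_ratBall {U : Set Plane} (hU : IsOpen U) {x : Plane} (hx : x ∈ U) :
    ∃ p, ratBall p ∈ 𝓝 x ∧ ratBall p ⊆ U := by
  obtain ⟨ε, hε, hεU⟩ := Metric.isOpen_iff.1 hU x hx
  obtain ⟨k, hk⟩ := exists_nat_one_div_lt (half_pos hε)
  have hk0 : (0 : ℝ) < 1 / (k + 1) := Nat.one_div_pos_of_nat
  obtain ⟨i, hi⟩ := (denseRange_denseSeq Plane).exists_dist_lt x hk0
  refine ⟨(i, k), ?_, ?_⟩
  · exact mem_of_superset (Metric.isOpen_ball.mem_nhds (Metric.mem_ball.2 hi))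
      Metric.ball_subset_closedBall
  · intro y hy
    refine hεU (Metric.mem_ball.2 ?_)
    have h1 : dist y (denseSeq Plane i) ≤ 1 / (k + 1) := hy
    have h2 := dist_triangle_right y x (denseSeq Plane i)
    linarith

/-- A compact set can be covered by finitely many of the balls of any family that contains a
neighbourhood of each of its points. -/
lemma exists_finset_ratBall {C : Set Plane} (hC : IsCompact C) {good : ℕ × ℕ → Prop}
    (h : ∀ x ∈ C, ∃ p, ratBall p ∈ 𝓝 x ∧ good p) :
    ∃ s : Finset (ℕ × ℕ), C ⊆ ⋃ p ∈ s, ratBall p ∧ ∀ p ∈ s, good p := by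
  classical
  choose! f hf hg using h
  obtain ⟨t, ht, hCt⟩ := hC.elim_nhds_subcover (fun x => ratBall (f x)) hf
  refine ⟨t.image f, ?_, ?_⟩
  · simpa using hCt
  · simp only [Finset.mem_image]
    rintro _ ⟨x, hx, rfl⟩
    exact hg x (ht x hx)

/-- Although the intersection of two closed sets is not continuous for the hit-and-miss topology,
the event that it misses a compact set is measurable: `C` is then a finite union of pieces each of
which is missed by one of the two sets. -/
lemma measurableSet_disjoint_inter {α : Type*} [MeasurableSpace α] {X Y : α → Closeds Plane}
    (hX : Measurable X) (hY : Measurable Y) {C : Set Plane} (hC : IsCompact C) :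
    MeasurableSet {a | Disjoint ((X a : Set Plane) ∩ Y a) C} := by
  have key : {a | Disjoint ((X a : Set Plane) ∩ Y a) C} =
      ⋃ s ∈ {s : Finset (ℕ × ℕ) | C ⊆ ⋃ p ∈ s, ratBall p},
        ⋂ p ∈ s, (X ⁻¹' missing (ratBall p ∩ C) ∪ Y ⁻¹' missing (ratBall p ∩ C)) := by
    ext a
    simp only [Set.mem_ofPred_eq, Set.mem_iUnion, Set.mem_iInter, Set.mem_union, Set.mem_preimage,
      mem_missing, exists_prop]
    constructor
    · intro h
      refine exists_finset_ratBall hC fun x hx => ?_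
      have : x ∉ (X a : Set Plane) ∨ x ∉ (Y a : Set Plane) := by
        by_contra! hxy
        exact Set.disjoint_left.1 h hxy hx
      rcases this with hx | hx
      · obtain ⟨p, hp, hpU⟩ := exists_ratBall (X a).isClosed.isOpen_compl hx
        exact ⟨p, hp, Or.inl (disjoint_compl_right.mono_right
          (Set.inter_subset_left.trans hpU))⟩
      · obtain ⟨p, hp, hpU⟩ := exists_ratBall (Y a).isClosed.isOpen_compl hx
        exact ⟨p, hp, Or.inr (disjoint_compl_right.mono_right
          (Set.inter_subset_left.trans hpU))⟩
    · rintro ⟨s, hCs, hs⟩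
      rw [Set.disjoint_left]
      rintro x ⟨hxX, hxY⟩ hxC
      obtain ⟨p, hp, hxp⟩ := Set.mem_iUnion₂.1 (hCs hxC)
      rcases hs p hp with h | h
      · exact Set.disjoint_left.1 h hxX ⟨hxp, hxC⟩
      · exact Set.disjoint_left.1 h hxY ⟨hxp, hxC⟩
  rw [key]
  refine MeasurableSet.biUnion (Set.to_countable _) fun s _ =>
    Finset.measurableSet_biInter _ fun p _ => ?_
  have := measurableSet_missing ((isCompact_ratBall p).inter hC)
  exact (hX this).union (hY this)

/-! ### The mixing property on a generating π-system and for functions -/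

/-- Convergence of a dominated family of measures extends from a generating π-system to the whole
σ-algebra; domination makes the class of good sets closed under countable disjoint unions. -/
lemma tendsto_real_of_piSystem {α ι : Type*} [m : MeasurableSpace α] {S : Set (Set α)}
    (hgen : m = MeasurableSpace.generateFrom S) (hpi : IsPiSystem S) (huniv : Set.univ ∈ S)
    {μ : Measure α} [IsFiniteMeasure μ] {ν : ι → Measure α} (hν : ∀ i, ν i ≤ μ)
    {l : Filter ι} {c : ℝ}
    (h : ∀ A ∈ S, Tendsto (fun i => (ν i).real A) l (𝓝 (c * μ.real A)))
    {A : Set α} (hA : MeasurableSet A) :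
    Tendsto (fun i => (ν i).real A) l (𝓝 (c * μ.real A)) := by
  have hfin : ∀ i, IsFiniteMeasure (ν i) := fun i => isFiniteMeasure_of_le μ (hν i)
  induction A, hA using MeasurableSpace.induction_on_inter hgen hpi with
  | empty => simpa using tendsto_const_nhds
  | basic A hA => exact h A hA
  | compl A hA ih =>
    simp only [measureReal_compl hA, mul_sub]
    exact (h _ huniv).sub ih
  | iUnion f hd hf ih =>
    have hsum : ∀ (ρ : Measure α) [IsFiniteMeasure ρ],
        HasSum (fun k => ρ.real (f k)) (ρ.real (⋃ k, f k)) := by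
      intro ρ _
      have h1 := measure_iUnion (μ := ρ) hd hf
      have h2 : ∑' k, ρ (f k) ≠ ⊤ := by rw [← h1]; exact measure_ne_top _ _
      have h3 := ENNReal.hasSum_toReal h2
      rwa [← ENNReal.tsum_toReal_eq (fun k => measure_ne_top _ _), ← h1] at h3
    have h1 : ∀ i, (ν i).real (⋃ k, f k) = ∑' k, (ν i).real (f k) :=
      fun i => (hsum (ν i)).tsum_eq.symm
    simp only [h1]
    rw [← ((hsum μ).mul_left c).tsum_eq]
    refine tendsto_tsum_of_dominated_convergence (hsum μ).summable ih
      (Eventually.of_forall fun i k => ?_)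
    rw [Real.norm_of_nonneg measureReal_nonneg]
    exact ENNReal.toReal_mono (measure_ne_top _ _) (hν i _)

instance : (Bornology.cobounded Plane).IsCountablyGenerated := by
  rw [← comap_norm_atTop]
  infer_instance

lemma integrable_of_mem_Icc {α : Type*} [MeasurableSpace α] {μ : Measure α} [IsFiniteMeasure μ]
    {h : α → ℝ} (hm : Measurable h) (h0 : ∀ a, 0 ≤ h a) (h1 : ∀ a, h a ≤ 1) : Integrable h μ := by
  refine Integrable.of_bound hm.aestronglyMeasurable 1 (ae_of_all _ fun a => ?_)
  rw [Real.norm_of_nonneg (h0 a)]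
  exact h1 a

lemma integral_eq_integral_levelSets {α : Type*} [MeasurableSpace α] {μ : Measure α}
    [IsFiniteMeasure μ] {h : α → ℝ} (hm : Measurable h) (h0 : ∀ a, 0 ≤ h a)
    (h1 : ∀ a, h a ≤ 1) : ∫ a, h a ∂μ = ∫ t in Set.Ioc 0 1, μ.real {a | t ≤ h a} :=
  (integrable_of_mem_Icc hm h0 h1).integral_eq_integral_Ioc_meas_le (ae_of_all _ h0)
    (ae_of_all _ h1)

section Mixing

variable {Ω : Type*} [MeasurableSpace Ω] {P : Measure Ω} [IsProbabilityMeasure P]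
  {Z : Ω → Closeds Plane}

lemma identDistrib_translate_of_missing (hZ : Measurable Z) (x : Plane)
    (h : ∀ C, IsCompact C →
      P.real {ω | translate x (Z ω) ∈ missing C} = P.real {ω | Z ω ∈ missing C}) :
    IdentDistrib (fun ω => translate x (Z ω)) Z P P := by
  have hZx : Measurable fun ω => translate x (Z ω) := (measurable_translate x).comp hZ
  refine ⟨hZx.aemeasurable, hZ.aemeasurable, ?_⟩
  have := Measure.isProbabilityMeasure_map (μ := P) hZx.aemeasurable
  have := Measure.isProbabilityMeasure_map (μ := P) hZ.aemeasurable
  refine ext_of_generate_finite _ generateFrom_missingSets isPiSystem_missingSets ?_ (by simp)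
  rintro _ ⟨C, hC, rfl⟩
  rw [Measure.map_apply hZx (measurableSet_missing hC),
    Measure.map_apply hZ (measurableSet_missing hC)]
  exact (measureReal_eq_measureReal_iff (by finiteness) (by finiteness)).1 (h C hC)

/-- The mixing property has to be checked on the families `missing C` only. -/
lemma tendsto_mixing_of_missing (hZ : Measurable Z)
    (hst : ∀ x, IdentDistrib (fun ω => translate x (Z ω)) Z P P)
    (h : ∀ C C', IsCompact C → IsCompact C' →
      Tendsto (fun x => P.real {ω | Z ω ∈ missing C ∧ translate x (Z ω) ∈ missing C'})
        (Bornology.cobounded Plane)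
        (𝓝 (P.real {ω | Z ω ∈ missing C} * P.real {ω | Z ω ∈ missing C'})))
    {A A' : Set (Closeds Plane)} (hA : MeasurableSet A) (hA' : MeasurableSet A') :
    Tendsto (fun x => P.real {ω | Z ω ∈ A ∧ translate x (Z ω) ∈ A'})
      (Bornology.cobounded Plane)
      (𝓝 (P.real {ω | Z ω ∈ A} * P.real {ω | Z ω ∈ A'})) := by
  have hZx : ∀ x, Measurable fun ω => translate x (Z ω) := fun x => (measurable_translate x).comp hZ
  have huniv : Set.univ ∈ missingSets := ⟨∅, isCompact_empty, missing_empty.symm⟩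
  have hlaw : ∀ {B : Set (Closeds Plane)}, MeasurableSet B →
      (P.map Z).real B = P.real {ω | Z ω ∈ B} := fun hB => map_measureReal_apply hZ hB
  have step : ∀ C, IsCompact C → ∀ B, MeasurableSet B →
      Tendsto (fun x => P.real {ω | Z ω ∈ missing C ∧ translate x (Z ω) ∈ B})
        (Bornology.cobounded Plane)
        (𝓝 (P.real {ω | Z ω ∈ missing C} * P.real {ω | Z ω ∈ B})) := by
    intro C hC B hB
    have hν : ∀ x {B : Set (Closeds Plane)}, MeasurableSet B →
        ((P.restrict (Z ⁻¹' missing C)).map (fun ω => translate x (Z ω))).real B =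
          P.real {ω | Z ω ∈ missing C ∧ translate x (Z ω) ∈ B} := by
      intro x B hB
      rw [map_measureReal_apply (hZx x) hB, measureReal_restrict_apply (hZx x hB), Set.inter_comm]
      rfl
    have := tendsto_real_of_piSystem generateFrom_missingSets isPiSystem_missingSets huniv
      (μ := P.map Z)
      (ν := fun x => (P.restrict (Z ⁻¹' missing C)).map (fun ω => translate x (Z ω)))
      (fun x => (Measure.map_mono Measure.restrict_le_self (hZx x)).trans (hst x).map_eq.le)
      (l := Bornology.cobounded Plane) (c := P.real {ω | Z ω ∈ missing C}) ?_ hB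
    · simpa only [hν _ hB, hlaw hB] using this
    · rintro _ ⟨C', hC', rfl⟩
      simpa only [hν _ (measurableSet_missing hC'), hlaw (measurableSet_missing hC')]
        using h C C' hC hC'
  have hν : ∀ x {B : Set (Closeds Plane)}, MeasurableSet B →
      ((P.restrict {ω | translate x (Z ω) ∈ A'}).map Z).real B =
        P.real {ω | Z ω ∈ B ∧ translate x (Z ω) ∈ A'} := by
    intro x B hB
    rw [map_measureReal_apply hZ hB, measureReal_restrict_apply (hZ hB)]
    rfl
  have := tendsto_real_of_piSystem generateFrom_missingSets isPiSystem_missingSets huniv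
    (μ := P.map Z) (ν := fun x => (P.restrict {ω | translate x (Z ω) ∈ A'}).map Z)
    (fun x => Measure.map_mono Measure.restrict_le_self hZ)
    (l := Bornology.cobounded Plane) (c := P.real {ω | Z ω ∈ A'}) ?_ hA
  · simpa only [hν _ hA, hlaw hA, mul_comm] using this
  · rintro _ ⟨C, hC, rfl⟩
    simpa only [hν _ (measurableSet_missing hC), hlaw (measurableSet_missing hC), mul_comm]
      using step C hC A' hA'

/-- Passage from level sets to functions by the layer-cake formula. -/
lemma tendsto_integral_of_levelSets {ι : Type*} {l : Filter ι} [l.IsCountablyGenerated]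
    {ν : ι → Measure Ω} (hν : ∀ i, ν i ≤ P) {h : ι → Ω → ℝ} (hm : ∀ i, Measurable (h i))
    (h0 : ∀ i ω, 0 ≤ h i ω) (h1 : ∀ i ω, h i ω ≤ 1) {φ : ℝ → ℝ}
    (hφ : ∀ t, Tendsto (fun i => (ν i).real {ω | t ≤ h i ω}) l (𝓝 (φ t))) :
    Tendsto (fun i => ∫ ω, h i ω ∂ν i) l (𝓝 (∫ t in Set.Ioc 0 1, φ t)) := by
  have hfin : ∀ i, IsFiniteMeasure (ν i) := fun i => isFiniteMeasure_of_le P (hν i)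
  have hcake : ∀ i, ∫ ω, h i ω ∂ν i = ∫ t in Set.Ioc 0 1, (ν i).real {ω | t ≤ h i ω} :=
    fun i => integral_eq_integral_levelSets (hm i) (h0 i) (h1 i)
  simp only [hcake]
  refine tendsto_integral_filter_of_dominated_convergence (fun _ => 1)
    (Eventually.of_forall fun i => ?_) (Eventually.of_forall fun i => ae_of_all _ fun t => ?_)
    (integrable_const _) (ae_of_all _ hφ)
  · have : Antitone fun t => (ν i).real {ω | t ≤ h i ω} :=
      fun s t hst => measureReal_mono fun ω hω => hst.trans hω
    exact this.measurable.aestronglyMeasurable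
  · rw [Real.norm_of_nonneg measureReal_nonneg]
    calc (ν i).real {ω | t ≤ h i ω} ≤ P.real {ω | t ≤ h i ω} :=
          ENNReal.toReal_mono (measure_ne_top _ _) (hν i _)
      _ ≤ 1 := measureReal_le_one

/-- The mixing property for functions with values in `[0, 1]` instead of events. -/
lemma tendsto_integral_mul_translate (hZ : Measurable Z)
    (hmix : ∀ A A' : Set (Closeds Plane), MeasurableSet A → MeasurableSet A' →
      Tendsto (fun x => P.real {ω | Z ω ∈ A ∧ translate x (Z ω) ∈ A'})
        (Bornology.cobounded Plane)
        (𝓝 (P.real {ω | Z ω ∈ A} * P.real {ω | Z ω ∈ A'})))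
    {f g : Closeds Plane → ℝ} (hf : Measurable f) (hg : Measurable g)
    (hf0 : ∀ F, 0 ≤ f F) (hf1 : ∀ F, f F ≤ 1) (hg0 : ∀ F, 0 ≤ g F) (hg1 : ∀ F, g F ≤ 1) :
    Tendsto (fun x => ∫ ω, f (Z ω) * g (translate x (Z ω)) ∂P) (Bornology.cobounded Plane)
      (𝓝 ((∫ ω, f (Z ω) ∂P) * ∫ ω, g (Z ω) ∂P)) := by
  have hZx : ∀ x, Measurable fun ω => translate x (Z ω) := fun x => (measurable_translate x).comp hZ
  have hgx : ∀ x, Measurable fun ω => g (translate x (Z ω)) := fun x => hg.comp (hZx x)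
  have step : ∀ A, MeasurableSet A →
      Tendsto (fun x => ∫ ω in Z ⁻¹' A, g (translate x (Z ω)) ∂P) (Bornology.cobounded Plane)
        (𝓝 (P.real {ω | Z ω ∈ A} * ∫ ω, g (Z ω) ∂P)) := by
    intro A hA
    rw [integral_eq_integral_levelSets (h := fun ω => g (Z ω)) (hg.comp hZ)
      (fun _ => hg0 _) (fun _ => hg1 _),
      ← integral_const_mul]
    refine tendsto_integral_of_levelSets (fun _ => Measure.restrict_le_self) hgx
      (fun _ _ => hg0 _) (fun _ _ => hg1 _) fun t => ?_
    have hB : MeasurableSet {F | t ≤ g F} := measurableSet_le measurable_const hg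
    refine (hmix A {F | t ≤ g F} hA hB).congr fun x => ?_
    have hB' : MeasurableSet {ω | t ≤ g (translate x (Z ω))} := hZx x hB
    rw [measureReal_restrict_apply hB', Set.inter_comm]
    rfl
  -- absorb the factor `g` into the measure
  have hdens : ∀ x, ∫ ω, f (Z ω) * g (translate x (Z ω)) ∂P =
      ∫ ω, f (Z ω) ∂(P.withDensity fun ω => ENNReal.ofReal (g (translate x (Z ω)))) := by
    intro x
    rw [integral_withDensity_eq_integral_toReal_smul (hgx x).ennreal_ofReal
      (ae_of_all _ fun _ => ENNReal.ofReal_lt_top)]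
    refine integral_congr_ae (ae_of_all _ fun ω => ?_)
    simp only [ENNReal.toReal_ofReal (hg0 _), smul_eq_mul, mul_comm]
  simp only [hdens]
  rw [integral_eq_integral_levelSets (h := fun ω => f (Z ω)) (hf.comp hZ)
    (fun _ => hf0 _) (fun _ => hf1 _),
    ← integral_mul_const]
  refine tendsto_integral_of_levelSets (P := P) (fun x => ?_) (fun _ => hf.comp hZ)
    (fun _ _ => hf0 _) (fun _ _ => hf1 _) fun t => ?_
  · calc P.withDensity (fun ω => ENNReal.ofReal (g (translate x (Z ω))))
        ≤ P.withDensity 1 := withDensity_mono (ae_of_all _ fun ω => by simpa using hg1 _)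
      _ = P := withDensity_one
  · have hB : MeasurableSet {F | t ≤ f F} := measurableSet_le measurable_const hf
    refine (step {F | t ≤ f F} hB).congr fun x => ?_
    have hB' : MeasurableSet {ω | t ≤ f (Z ω)} := hZ hB
    rw [measureReal_def, Function.comp_def, withDensity_apply _ hB',
      integral_eq_lintegral_of_nonneg_ae (ae_of_all _ fun _ => hg0 _)
        (hgx x).aestronglyMeasurable]
    rfl

end Mixing

/-! ### Cells and edges of a tessellation -/

/-- The union of the boundaries of the cells. -/
def edges (Ξ : ℕ → Set Plane) : Set Plane := ⋃ n, frontier (Ξ n)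

lemma RandomTessellation.coe_edgeSet {Ω : Type*} [MeasurableSpace Ω] (T : RandomTessellation Ω)
    (ω : Ω) : (T.edgeSet ω : Set Plane) = edges fun n => (T.cell n ω : Set Plane) := rfl

namespace IsTessellation

variable {Ξ : ℕ → Set Plane}

lemma convex (h : IsTessellation Ξ) (n : ℕ) : Convex ℝ (Ξ n) := by
  obtain ⟨V, -, hV⟩ := h.polygon n
  rw [hV]
  exact convex_convexHull ℝ V

lemma isCompact (h : IsTessellation Ξ) (n : ℕ) : IsCompact (Ξ n) := by
  obtain ⟨V, hVf, hV⟩ := h.polygon n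
  rw [hV]
  exact hVf.isCompact_convexHull ℝ

/-- The interior of a cell does not meet any other cell, because a convex set with nonempty interior
is the closure of its interior. -/
lemma eq_of_mem_interior (h : IsTessellation Ξ) {m n : ℕ} {x : Plane} (hm : x ∈ Ξ m)
    (hn : x ∈ interior (Ξ n)) : m = n := by
  by_contra hmn
  have hx : x ∈ closure (interior (Ξ m)) := by
    rw [(h.convex m).closure_interior_eq_closure_of_nonempty_interior (h.interior_nonempty m)]
    exact subset_closure hm
  obtain ⟨y, hyn, hym⟩ := mem_closure_iff.1 hx _ isOpen_interior hn
  exact Set.disjoint_left.1 (h.interior_disjoint m n hmn) hym hyn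

lemma mem_interior_of_notMem_edges {n : ℕ} {x : Plane} (hn : x ∈ Ξ n) (hx : x ∉ edges Ξ) :
    x ∈ interior (Ξ n) := by
  by_contra hxi
  exact hx (Set.mem_iUnion.2 ⟨n, subset_closure hn, hxi⟩)

/-- A point is on the edges if and only if it belongs to two cells. -/
lemma mem_edges_iff (h : IsTessellation Ξ) {x : Plane} :
    x ∈ edges Ξ ↔ ∃ m n, m ≠ n ∧ x ∈ Ξ m ∩ Ξ n := by
  constructor
  · intro hx
    obtain ⟨n, hn⟩ := Set.mem_iUnion.1 hx
    have hclosed : IsClosed (⋃ m : {m // m ≠ n}, Ξ m) :=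
      (h.locallyFinite.comp_injective Subtype.val_injective).isClosed_iUnion
        fun m => (h.isCompact m).isClosed
    have hsub : (Ξ n)ᶜ ⊆ ⋃ m : {m // m ≠ n}, Ξ m := by
      intro y hy
      obtain ⟨m, hm⟩ := Set.mem_iUnion.1 (h.cover ▸ Set.mem_univ y)
      exact Set.mem_iUnion.2 ⟨⟨m, fun hmn => hy (hmn ▸ hm)⟩, hm⟩
    have hx' : x ∈ closure (Ξ n)ᶜ := by
      rw [frontier_eq_closure_inter_closure] at hn
      exact hn.2
    obtain ⟨⟨m, hmn⟩, hm⟩ := Set.mem_iUnion.1 (closure_minimal hsub hclosed hx')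
    exact ⟨m, n, hmn, hm, (h.isCompact n).isClosed.frontier_subset hn⟩
  · rintro ⟨m, n, hmn, hm, hn⟩
    by_contra hx
    exact hmn (h.eq_of_mem_interior hm (mem_interior_of_notMem_edges hn hx))

lemma subset_interior_of_isPreconnected {K : Set Plane} (hK : IsPreconnected K)
    (hd : Disjoint (edges Ξ) K) {n : ℕ} (hn : (K ∩ Ξ n).Nonempty) : K ⊆ interior (Ξ n) := by
  have hf : Disjoint (frontier (Ξ n)) K :=
    hd.mono_left (Set.subset_iUnion (fun n => frontier (Ξ n)) n)
  refine (isPreconnected_iff_subset_of_disjoint.1 hK (interior (Ξ n)) (closure (Ξ n))ᶜ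
    isOpen_interior isClosed_closure.isOpen_compl (fun y hy => ?_) ?_).resolve_right fun h => ?_
  · by_contra hy'
    simp only [Set.mem_union, Set.mem_compl_iff, not_or, not_not] at hy'
    exact Set.disjoint_right.1 hf hy ⟨hy'.2, hy'.1⟩
  · refine Set.eq_empty_of_forall_notMem fun y hy => hy.2.2 ?_
    exact subset_closure (interior_subset hy.2.1)
  · obtain ⟨y, hyK, hyn⟩ := hn
    exact h hyK (subset_closure hyn)

/-- Two points off the edges belong to the same cell if and only if the segment between them does
not meet the edges. -/
lemma disjoint_edges_segment_iff (h : IsTessellation Ξ) {m n : ℕ} {x y : Plane}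
    (hx : x ∈ interior (Ξ m)) (hy : y ∈ interior (Ξ n)) :
    Disjoint (edges Ξ) (segment ℝ x y) ↔ m = n := by
  constructor
  · intro hd
    have := subset_interior_of_isPreconnected (convex_segment x y).isPreconnected hd
      ⟨x, left_mem_segment ℝ x y, interior_subset hx⟩
    exact (h.eq_of_mem_interior (interior_subset hy) (this (right_mem_segment ℝ x y))).symm
  · rintro rfl
    rw [Set.disjoint_right]
    intro z hz hze
    have hz' : z ∈ interior (Ξ m) := (h.convex m).interior.segment_subset hx hy hz
    obtain ⟨k, l, hkl, hk, hl⟩ := h.mem_edges_iff.1 hze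
    exact hkl ((h.eq_of_mem_interior hk hz').trans (h.eq_of_mem_interior hl hz').symm)

lemma finite_inter_nonempty (h : IsTessellation Ξ) {C : Set Plane} (hC : IsCompact C) :
    {n | (Ξ n ∩ C).Nonempty}.Finite :=
  h.locallyFinite.finite_nonempty_inter_compact hC

lemma translate (h : IsTessellation Ξ) (x : Plane) :
    IsTessellation fun n => (fun y => y + x) '' Ξ n where
  polygon n := by
    obtain ⟨V, hVf, hV⟩ := h.polygon n
    refine ⟨(fun y => y + x) '' V, hVf.image _, ?_⟩
    rw [hV]
    exact (AffineMap.image_convexHull ((AffineEquiv.vaddConst ℝ x).toAffineMap.comp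
      (AffineMap.id ℝ Plane)) V)
  interior_nonempty n := by
    have : interior ((fun y => y + x) '' Ξ n) = (fun y => y + x) '' interior (Ξ n) :=
      ((Homeomorph.addRight x).image_interior (Ξ n)).symm
    rw [this]
    exact (h.interior_nonempty n).image _
  interior_disjoint m n hmn := by
    have : ∀ n, interior ((fun y => y + x) '' Ξ n) = (fun y => y + x) '' interior (Ξ n) :=
      fun n => ((Homeomorph.addRight x).image_interior (Ξ n)).symm
    rw [this, this, Set.disjoint_image_iff (add_left_injective x)]
    exact h.interior_disjoint m n hmn
  cover := by
    rw [← Set.image_iUnion, h.cover, Set.image_univ]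
    exact (Homeomorph.addRight x).surjective.range_eq
  locallyFinite := by
    have := h.locallyFinite.preimage_continuous (Homeomorph.addRight x).symm.continuous
    convert this using 2 with n
    exact (Homeomorph.addRight x).image_eq_preimage_symm (Ξ n)

end IsTessellation

lemma edges_translate (Ξ : ℕ → Set Plane) (x : Plane) :
    edges (fun n => (fun y => y + x) '' Ξ n) = (fun y => y + x) '' edges Ξ := by
  rw [edges, edges, Set.image_iUnion]
  exact Set.iUnion_congr fun n => ((Homeomorph.addRight x).image_frontier (Ξ n)).symm

/-! ### Products over cells as functions of the edge set -/

open Classical in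
/-- The product of `q (Ξ n ∩ C)` over all cells if no edge meets `C`, and `0` otherwise. If `q` is
the void probability functional of independent random closed sets `S n`, this is the probability
that the tessellation in which each cell `Ξ n` is subdivided by `S n` has no edge that
meets `C`. -/
noncomputable def cellProd (q : Set Plane → ℝ) (C : Set Plane) (Ξ : ℕ → Set Plane) : ℝ :=
  if Disjoint (edges Ξ) C then ∏ᶠ n, q (Ξ n ∩ C) else 0

lemma cellProd_eq_prod {q : Set Plane → ℝ} (hq : q ∅ = 1) {C : Set Plane} {Ξ : ℕ → Set Plane}
    (hd : Disjoint (edges Ξ) C) {s : Finset ℕ} (hs : ∀ n, (Ξ n ∩ C).Nonempty → n ∈ s) :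
    cellProd q C Ξ = ∏ n ∈ s, q (Ξ n ∩ C) := by
  rw [cellProd, if_pos hd]
  refine finprod_eq_prod_of_mulSupport_subset _ fun n hn => ?_
  refine hs n (Set.nonempty_iff_ne_empty.2 fun h => hn ?_)
  simp only [h, hq]

lemma cellProd_of_not_disjoint (q : Set Plane → ℝ) {C : Set Plane} {Ξ : ℕ → Set Plane}
    (hd : ¬ Disjoint (edges Ξ) C) : cellProd q C Ξ = 0 := if_neg hd

lemma cellProd_nonneg {q : Set Plane → ℝ} (hq : ∀ K, 0 ≤ q K) (C : Set Plane)
    (Ξ : ℕ → Set Plane) : 0 ≤ cellProd q C Ξ := by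
  rw [cellProd]
  split_ifs
  · exact finprod_nonneg fun n => hq _
  · exact le_rfl

open Classical in
/-- Call two balls of a finite family `s` equivalent if the segment between their centres misses
`F`. `blockProd` is the product of the values of `q` at the parts of `C` that are covered by the
equivalence classes. If `F` is the edge set of a tessellation and misses the balls, these classes
collect the balls that lie in the same cell. For measurability, the product runs over all `t ⊆ s`,
with factor `1` if `t` is not a class. -/
noncomputable def blockProd (q : Set Plane → ℝ) (C : Set Plane) (s : Finset (ℕ × ℕ))
    (F : Closeds Plane) : ℝ :=
  ∏ t ∈ s.powerset, if ∃ i ∈ s, ∀ j ∈ s, (F ∈ missing (segment ℝ (denseSeq Plane i.1)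
    (denseSeq Plane j.1)) ↔ j ∈ t) then q (⋃ j ∈ t, ratBall j ∩ C) else 1

lemma isCompact_segment (x y : Plane) : IsCompact (segment ℝ x y) := by
  rw [← convexHull_pair]
  exact (Set.toFinite {x, y}).isCompact_convexHull ℝ

lemma measurable_blockProd (q : Set Plane → ℝ) (C : Set Plane) (s : Finset (ℕ × ℕ)) :
    Measurable (blockProd q C s) := by
  classical
  refine Finset.measurable_fun_prod _ fun t _ => Measurable.ite ?_ measurable_const measurable_const
  have : {F : Closeds Plane | ∃ i ∈ s, ∀ j ∈ s, (F ∈ missing (segment ℝ (denseSeq Plane i.1)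
      (denseSeq Plane j.1)) ↔ j ∈ t)} = ⋃ i ∈ s, ⋂ j ∈ s,
      {F | F ∈ missing (segment ℝ (denseSeq Plane i.1) (denseSeq Plane j.1)) ↔ j ∈ t} := by
    ext F
    simp
  rw [this]
  refine Finset.measurableSet_biUnion _ fun i _ => Finset.measurableSet_biInter _ fun j _ => ?_
  have h := measurableSet_missing
    (isCompact_segment (denseSeq Plane i.1) (denseSeq Plane j.1))
  by_cases hj : j ∈ t
  · simpa only [hj, iff_true] using! h
  · simpa only [hj, iff_false] using! h.compl

lemma blockProd_mem_Icc {q : Set Plane → ℝ} (hq0 : ∀ K, 0 ≤ q K) (hq1 : ∀ K, q K ≤ 1)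
    (C : Set Plane) (s : Finset (ℕ × ℕ)) (F : Closeds Plane) :
    blockProd q C s F ∈ Set.Icc 0 1 := by
  refine ⟨Finset.prod_nonneg fun t _ => ?_, Finset.prod_le_one (fun t _ => ?_) fun t _ => ?_⟩ <;>
  split_ifs <;> simp [hq0, hq1]

lemma blockProd_eq_cellProd {q : Set Plane → ℝ} (hq : q ∅ = 1) {C : Set Plane}
    {s : Finset (ℕ × ℕ)} (hs : C ⊆ ⋃ p ∈ s, ratBall p) {Ξ : ℕ → Set Plane}
    (hΞ : IsTessellation Ξ) {F : Closeds Plane} (hF : (F : Set Plane) = edges Ξ)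
    (hFs : ∀ p ∈ s, F ∈ missing (ratBall p)) :
    blockProd q C s F = cellProd q C Ξ := by
  classical
  have hcen : ∀ p, denseSeq Plane p.1 ∈ ratBall p := fun p =>
    Metric.mem_closedBall_self Nat.one_div_pos_of_nat.le
  have hdC : Disjoint (edges Ξ) C := by
    rw [Set.disjoint_right]
    intro x hxC hx
    obtain ⟨p, hp, hxp⟩ := Set.mem_iUnion₂.1 (hs hxC)
    exact Set.disjoint_left.1 (hFs p hp) (hF ▸ hx) hxp
  -- `c p` is the index of the cell that contains the ball `p`
  have hc : ∀ p, ∃ n, p ∈ s → ratBall p ⊆ interior (Ξ n) := by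
    intro p
    obtain ⟨n, hn⟩ := Set.mem_iUnion.1 (hΞ.cover ▸ Set.mem_univ (denseSeq Plane p.1))
    refine ⟨n, fun hp => IsTessellation.subset_interior_of_isPreconnected
      (convex_closedBall _ _).isPreconnected (hF ▸ hFs p hp) ⟨_, hcen p, hn⟩⟩
  choose c hc using hc
  have hrel : ∀ i ∈ s, ∀ j ∈ s, (F ∈ missing (segment ℝ (denseSeq Plane i.1)
      (denseSeq Plane j.1)) ↔ c i = c j) := by
    intro i hi j hj
    rw [mem_missing, hF]
    exact hΞ.disjoint_edges_segment_iff (hc i hi (hcen i)) (hc j hj (hcen j))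
  have hcell : ∀ n, Ξ n ∩ C = ⋃ j ∈ s.filter (fun j => c j = n), ratBall j ∩ C := by
    intro n
    ext x
    simp only [Set.mem_inter_iff, Set.mem_iUnion, Finset.mem_filter, exists_prop]
    constructor
    · rintro ⟨hxn, hxC⟩
      obtain ⟨p, hp, hxp⟩ := Set.mem_iUnion₂.1 (hs hxC)
      exact ⟨p, ⟨hp, (hΞ.eq_of_mem_interior hxn (hc p hp hxp)).symm⟩, hxp, hxC⟩
    · rintro ⟨p, ⟨hp, rfl⟩, hxp, hxC⟩
      exact ⟨interior_subset (hc p hp hxp), hxC⟩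
  rw [cellProd_eq_prod hq hdC (s := s.image c)]
  · have himage : s.powerset.filter (fun t => ∃ i ∈ s, ∀ j ∈ s, (F ∈ missing
        (segment ℝ (denseSeq Plane i.1) (denseSeq Plane j.1)) ↔ j ∈ t)) =
        (s.image c).image fun n => s.filter fun j => c j = n := by
      ext t
      simp only [Finset.mem_filter, Finset.mem_powerset, Finset.mem_image,
        exists_exists_and_eq_and]
      constructor
      · rintro ⟨hts, i, hi, h⟩
        refine ⟨i, hi, ?_⟩
        ext j
        rw [Finset.mem_filter]
        constructor
        · rintro ⟨hj, hij⟩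
          exact (h j hj).1 ((hrel i hi j hj).2 hij.symm)
        · intro hj
          exact ⟨hts hj, ((hrel i hi j (hts hj)).1 ((h j (hts hj)).2 hj)).symm⟩
      · rintro ⟨i, hi, rfl⟩
        refine ⟨Finset.filter_subset _ _, i, hi, fun j hj => ?_⟩
        rw [hrel i hi j hj, Finset.mem_filter]
        simp [hj, eq_comm]
    rw [blockProd, ← Finset.prod_filter]
    refine (Finset.prod_congr (s₂ := (s.image c).image fun n => s.filter fun j => c j = n)
      (by convert himage) fun _ _ => rfl).trans ((Finset.prod_image ?_).trans ?_)
    rotate_left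
    · exact Finset.prod_congr rfl fun n _ => by rw [hcell n]
    · intro m hm n hn hmn
      obtain ⟨i, hi, rfl⟩ := Finset.mem_image.1 hm
      have : i ∈ s.filter fun j => c j = n :=
        (Finset.ext_iff.1 hmn i).1 (Finset.mem_filter.2 ⟨hi, rfl⟩)
      exact (Finset.mem_filter.1 this).2
  · rintro n ⟨x, hxn, hxC⟩
    obtain ⟨p, hp, hxp⟩ := Set.mem_iUnion₂.1 (hs hxC)
    exact Finset.mem_image.2 ⟨p, hp, (hΞ.eq_of_mem_interior hxn (hc p hp hxp)).symm⟩

/-- `cellProd` is a measurable function of the edge set alone: it depends neither on the order of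
the cells nor on other information in the sequence of the cells. -/
lemma exists_measurable_eq_cellProd {q : Set Plane → ℝ} (hq : q ∅ = 1) (hq0 : ∀ K, 0 ≤ q K)
    (hq1 : ∀ K, q K ≤ 1) {C : Set Plane} (hC : IsCompact C) :
    ∃ G : Closeds Plane → ℝ, Measurable G ∧ (∀ F, 0 ≤ G F) ∧ (∀ F, G F ≤ 1) ∧
      ∀ Ξ, IsTessellation Ξ → ∀ F : Closeds Plane, (F : Set Plane) = edges Ξ →
        G F = cellProd q C Ξ := by
  classical
  let E : Finset (ℕ × ℕ) → Set (Closeds Plane) := fun s =>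
    {F | C ⊆ ⋃ p ∈ s, ratBall p} ∩ ⋂ p ∈ s, missing (ratBall p)
  have hE : ∀ s, MeasurableSet (E s) := fun s => (MeasurableSet.const _).inter
    (Finset.measurableSet_biInter _ fun p _ => measurableSet_missing (isCompact_ratBall p))
  -- on edge sets, all nonzero terms of the supremum have the same value
  let g : Finset (ℕ × ℕ) → Closeds Plane → ℝ := fun s => (E s).indicator (blockProd q C s)
  have hg0 : ∀ s F, 0 ≤ g s F := fun s F =>
    Set.indicator_nonneg (fun F _ => (blockProd_mem_Icc hq0 hq1 C s F).1) F
  have hg1 : ∀ s F, g s F ≤ 1 := fun s F =>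
    Set.indicator_le' (fun F _ => (blockProd_mem_Icc hq0 hq1 C s F).2) (fun _ _ => zero_le_one) F
  have hbdd : ∀ F, BddAbove (Set.range fun s => g s F) := fun F =>
    ⟨1, Set.forall_mem_range.2 fun s => hg1 s F⟩
  refine ⟨fun F => ⨆ s, g s F,
    Measurable.iSup fun s => (measurable_blockProd q C s).indicator (hE s),
    fun F => Real.iSup_nonneg fun s => hg0 s F, fun F => ciSup_le fun s => hg1 s F, ?_⟩
  intro Ξ hΞ F hF
  have hmem : ∀ s, F ∈ E s → g s F = cellProd q C Ξ := by
    intro s hs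
    rw [show g s F = blockProd q C s F from Set.indicator_of_mem hs _]
    exact blockProd_eq_cellProd hq hs.1 hΞ hF (Set.mem_iInter₂.1 hs.2)
  apply le_antisymm
  · refine ciSup_le fun s => ?_
    by_cases hs : F ∈ E s
    · exact (hmem s hs).le
    · rw [show g s F = 0 from Set.indicator_of_notMem hs _]
      exact cellProd_nonneg hq0 C Ξ
  · by_cases hd : Disjoint (edges Ξ) C
    · obtain ⟨s, hCs, hs⟩ := exists_finset_ratBall hC
        (good := fun p => F ∈ missing (ratBall p)) <| by
        intro x hx
        obtain ⟨p, hp, hpU⟩ := exists_ratBall F.isClosed.isOpen_compl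
          (x := x) (fun hxF => Set.disjoint_right.1 hd hx (hF ▸ hxF))
        exact ⟨p, hp, disjoint_compl_right.mono_right hpU⟩
      rw [← hmem s ⟨hCs, Set.mem_iInter₂.2 hs⟩]
      exact le_ciSup (hbdd F) s
    · rw [cellProd_of_not_disjoint q hd]
      exact Real.iSup_nonneg fun s => hg0 s F

/-- `cellProd` is multiplicative for compact sets that are not met by a common cell. -/
lemma cellProd_union {q : Set Plane → ℝ} (hq : q ∅ = 1) {C C' : Set Plane} (hC : IsCompact C)
    (hC' : IsCompact C') {Ξ : ℕ → Set Plane} (hΞ : IsTessellation Ξ)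
    (h : ∀ n, Ξ n ∩ C = ∅ ∨ Ξ n ∩ C' = ∅) :
    cellProd q (C ∪ C') Ξ = cellProd q C Ξ * cellProd q C' Ξ := by
  by_cases hd : Disjoint (edges Ξ) C
  swap
  · rw [cellProd_of_not_disjoint q hd, cellProd_of_not_disjoint q (fun h => hd
      (Set.disjoint_union_right.1 h).1), zero_mul]
  by_cases hd' : Disjoint (edges Ξ) C'
  swap
  · rw [cellProd_of_not_disjoint q hd', cellProd_of_not_disjoint q (fun h => hd'
      (Set.disjoint_union_right.1 h).2), mul_zero]
  have hfin := hΞ.finite_inter_nonempty (hC.union hC')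
  have hs : ∀ n, (Ξ n ∩ (C ∪ C')).Nonempty → n ∈ hfin.toFinset := fun n hn =>
    hfin.mem_toFinset.2 hn
  rw [cellProd_eq_prod hq (Set.disjoint_union_right.2 ⟨hd, hd'⟩) hs,
    cellProd_eq_prod hq hd fun n hn => hs n (hn.mono (by gcongr; exact Set.subset_union_left)),
    cellProd_eq_prod hq hd' fun n hn => hs n (hn.mono (by gcongr; exact Set.subset_union_right)),
    ← Finset.prod_mul_distrib]
  refine Finset.prod_congr rfl fun n _ => ?_
  rw [Set.inter_union_distrib_left]
  rcases h n with h | h <;> simp [h, hq]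

lemma cellProd_preimage_add {q : Set Plane → ℝ} {x : Plane}
    (hq : ∀ K, IsCompact K → q ((fun y => y + x) ⁻¹' K) = q K) {C : Set Plane} (hC : IsCompact C)
    {Ξ : ℕ → Set Plane} (hΞ : IsTessellation Ξ) :
    cellProd q ((fun y => y + x) ⁻¹' C) Ξ = cellProd q C fun n => (fun y => y + x) '' Ξ n := by
  have hcell : ∀ n, q (Ξ n ∩ (fun y => y + x) ⁻¹' C) = q ((fun y => y + x) '' Ξ n ∩ C) := by
    intro n
    rw [← hq _ (((hΞ.translate x).isCompact n).inter hC), Set.preimage_inter,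
      Set.preimage_image_eq _ (add_left_injective x)]
  rw [cellProd, cellProd, edges_translate, Set.disjoint_image_left]
  simp only [hcell]

/-- Since the finitely many cells that meet `C` are bounded, none of them meets a remote translate
of `C'`. -/
lemma eventually_cellProd_union {q : Set Plane → ℝ} (hq : q ∅ = 1) {C C' : Set Plane}
    (hC : IsCompact C) (hC' : IsCompact C') {Ξ : ℕ → Set Plane} (hΞ : IsTessellation Ξ) :
    ∀ᶠ x in Bornology.cobounded Plane, cellProd q (C ∪ (fun y => y + x) ⁻¹' C') Ξ =
      cellProd q C Ξ * cellProd q ((fun y => y + x) ⁻¹' C') Ξ := by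
  have hB : Bornology.IsBounded (⋃ n ∈ {n | (Ξ n ∩ C).Nonempty}, Ξ n) :=
    (Bornology.isBounded_biUnion (hΞ.finite_inter_nonempty hC)).2
      fun n _ => (hΞ.isCompact n).isBounded
  obtain ⟨r, hr⟩ := hB.exists_norm_le
  obtain ⟨r', hr'⟩ := hC'.isBounded.exists_norm_le
  filter_upwards [(tendsto_norm_cobounded_atTop (E := Plane)).eventually_gt_atTop (r + r')]
    with x hx
  refine cellProd_union hq hC (isCompact_preimage_add hC' x) hΞ fun n => ?_
  by_contra! hn
  obtain ⟨hn, y, hyn, hyx⟩ := hn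
  have h1 : ‖y‖ ≤ r := hr y (Set.mem_biUnion hn hyn)
  have h2 : ‖y + x‖ ≤ r' := hr' _ hyx
  have h3 : ‖x‖ ≤ ‖y + x‖ + ‖y‖ := by
    simpa using norm_sub_le (y + x) y
  linarith

/-! ### Void probabilities of random tessellations -/

lemma IsTessellation.disjoint_edges_iff {Ξ : ℕ → Set Plane} (h : IsTessellation Ξ)
    {C : Set Plane} : Disjoint (edges Ξ) C ↔ ∀ m n, m ≠ n → Disjoint (Ξ m ∩ Ξ n) C := by
  simp only [Set.disjoint_left, h.mem_edges_iff]
  exact ⟨fun H m n hmn x hx => H ⟨m, n, hmn, hx⟩, fun H x ⟨m, n, hmn, hx⟩ => H m n hmn hx⟩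

lemma RandomTessellation.measurable_edgeSet {Ω : Type*} [MeasurableSpace Ω]
    (T : RandomTessellation Ω) : Measurable T.edgeSet := by
  refine measurable_of_missing fun C hC => ?_
  have : T.edgeSet ⁻¹' missing C =
      ⋂ (m) (n) (_ : m ≠ n), {ω | Disjoint ((T.cell m ω : Set Plane) ∩ T.cell n ω) C} := by
    ext ω
    simp only [Set.mem_iInter, Set.mem_preimage, mem_missing, T.coe_edgeSet]
    exact (T.isTessellation ω).disjoint_edges_iff
  rw [this]
  exact MeasurableSet.iInter fun m => MeasurableSet.iInter fun n => MeasurableSet.iInter fun _ =>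
    measurableSet_disjoint_inter (T.measurable_cell m) (T.measurable_cell n) hC

lemma mem_missing_and_translate_iff {F : Closeds Plane} {x : Plane} {C C' : Set Plane} :
    F ∈ missing C ∧ translate x F ∈ missing C' ↔
      F ∈ missing (C ∪ (fun y => y + x) ⁻¹' C') := by
  rw [translate_mem_missing, ← missing_inter]
  rfl

section

variable {Ω Ω' : Type*} [MeasurableSpace Ω] [MeasurableSpace Ω'] {P : Measure Ω}
  {P' : Measure Ω'}

lemma RandomTessellation.IsStationary.real_missing {T : RandomTessellation Ω}
    (hT : T.IsStationary P) (x : Plane) {C : Set Plane} (hC : IsCompact C) :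
    P.real {ω | T.edgeSet ω ∈ missing ((fun y => y + x) ⁻¹' C)} =
      P.real {ω | T.edgeSet ω ∈ missing C} := by
  simp only [← translate_mem_missing]
  exact congrArg ENNReal.toReal ((hT x).measure_mem_eq (measurableSet_missing hC))

/-- Stationarity and mixing are properties of the void probabilities of the edge set. -/
lemma RandomTessellation.isMixing_of_missing [IsProbabilityMeasure P] {T : RandomTessellation Ω}
    (hst : ∀ x C, IsCompact C → P.real {ω | T.edgeSet ω ∈ missing ((fun y => y + x) ⁻¹' C)} =
      P.real {ω | T.edgeSet ω ∈ missing C})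
    (hmix : ∀ C C', IsCompact C → IsCompact C' →
      Tendsto (fun x => P.real {ω | T.edgeSet ω ∈ missing (C ∪ (fun y => y + x) ⁻¹' C')})
        (Bornology.cobounded Plane)
        (𝓝 (P.real {ω | T.edgeSet ω ∈ missing C} * P.real {ω | T.edgeSet ω ∈ missing C'}))) :
    T.IsMixing P := by
  have hst' : T.IsStationary P := fun x =>
    identDistrib_translate_of_missing T.measurable_edgeSet x fun C hC => by
      simpa only [translate_mem_missing] using hst x C hC
  refine ⟨hst', fun A A' hA hA' =>
    tendsto_mixing_of_missing T.measurable_edgeSet hst' (fun C C' hC hC' => ?_) hA hA'⟩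
  simpa only [mem_missing_and_translate_iff] using hmix C C' hC hC'

/-! ### Superpositions -/

theorem IsSuperposition.isMixing [IsProbabilityMeasure P] {T T₁ T₂ : RandomTessellation Ω}
    (h₁ : T₁.IsMixing P)
    (h₂ : T₂.IsMixing P) (h : IsSuperposition P T T₁ T₂) : T.IsMixing P := by
  obtain ⟨hind, hT⟩ := h
  have key : ∀ C, IsCompact C → P.real {ω | T.edgeSet ω ∈ missing C} =
      P.real {ω | T₁.edgeSet ω ∈ missing C} * P.real {ω | T₂.edgeSet ω ∈ missing C} := by
    intro C hC
    have hm := measurableSet_missing hC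
    have h1 : {ω | T.edgeSet ω ∈ missing C} =ᵐ[P]
        (T₁.edgeSet ⁻¹' missing C ∩ T₂.edgeSet ⁻¹' missing C : Set Ω) := by
      refine eventuallyEq_set.2 (hT.mono fun ω hω => ?_)
      rw [Set.mem_ofPred_eq, mem_missing, hω, Set.disjoint_union_left]
      rfl
    rw [measureReal_congr h1, measureReal_def,
      hind.measure_inter_preimage_eq_mul _ _ hm hm, ENNReal.toReal_mul]
    rfl
  refine RandomTessellation.isMixing_of_missing (fun x C hC => ?_) fun C C' hC hC' => ?_
  · rw [key _ (isCompact_preimage_add hC x), key C hC, h₁.1.real_missing x hC,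
      h₂.1.real_missing x hC]
  · have l₁ := h₁.2 _ _ (measurableSet_missing hC) (measurableSet_missing hC')
    have l₂ := h₂.2 _ _ (measurableSet_missing hC) (measurableSet_missing hC')
    simp only [mem_missing_and_translate_iff] at l₁ l₂
    rw [key C hC, key C' hC', mul_mul_mul_comm]
    exact (l₁.mul l₂).congr fun x => (key _ (hC.union (isCompact_preimage_add hC' x))).symm

/-! ### Nestings -/

/-- The void probability functional `K ↦ P(T⁽¹⁾ ∩ K = ∅)` of the edge set of `T`. -/
noncomputable def RandomTessellation.void (T : RandomTessellation Ω) (P : Measure Ω)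
    (K : Set Plane) : ℝ := P.real {ω | T.edgeSet ω ∈ missing K}

/-- The void probabilities of the tessellation in which the cells of a fixed tessellation are
subdivided by independent copies of `T₂`. -/
lemma real_forall_disjoint [IsProbabilityMeasure P'] {S : ℕ → RandomTessellation Ω}
    {T₂ : RandomTessellation Ω'}
    (hS : ∀ n, IdentDistrib (S n).edgeSet T₂.edgeSet P P')
    (hind : iIndepFun (fun n => (S n).edgeSet) P) {C : Set Plane} (hC : IsCompact C)
    {Ξ : ℕ → Set Plane} (hΞ : IsTessellation Ξ) (hd : Disjoint (edges Ξ) C) :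
    P.real {ω | ∀ n, Disjoint (Ξ n ∩ (S n).edgeSet ω) C} = cellProd (T₂.void P') C Ξ := by
  have hfin := hΞ.finite_inter_nonempty hC
  have hvoid : T₂.void P' ∅ = 1 := by simp [RandomTessellation.void, missing_empty]
  have hm : ∀ n, MeasurableSet (missing (Ξ n ∩ C)) := fun n =>
    measurableSet_missing ((hΞ.isCompact n).inter hC)
  have hset : {ω | ∀ n, Disjoint (Ξ n ∩ (S n).edgeSet ω) C} =
      ⋂ n ∈ hfin.toFinset, (S n).edgeSet ⁻¹' missing (Ξ n ∩ C) := by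
    ext ω
    simp only [Set.mem_ofPred_eq, Set.mem_iInter, Set.mem_preimage, mem_missing,
      Set.Finite.mem_toFinset, Set.disjoint_left, Set.mem_inter_iff]
    exact ⟨fun h n _ x hxS hx => h n ⟨hx.1, hxS⟩ hx.2,
      fun h n x hx hxC => h n ⟨x, hx.1, hxC⟩ hx.2 ⟨hx.1, hxC⟩⟩
  rw [hset, measureReal_def, hind.measure_inter_preimage_eq_mul _ (fun n _ => hm n),
    ENNReal.toReal_prod, cellProd_eq_prod hvoid hd fun n hn => hfin.mem_toFinset.2 hn]
  exact Finset.prod_congr rfl fun n _ =>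
    congrArg ENNReal.toReal ((hS n).measure_mem_eq (hm n))

/-- The void probabilities of a nesting, computed by conditioning on the initial tessellation. -/
lemma IsNesting.real_missing [IsProbabilityMeasure P] [IsProbabilityMeasure P']
    {T T₁ : RandomTessellation Ω} {T₂ : RandomTessellation Ω'}
    (h : IsNesting P P' T T₁ T₂) {C : Set Plane} (hC : IsCompact C) :
    P.real {ω | T.edgeSet ω ∈ missing C} =
      ∫ ω, cellProd (T₂.void P') C (fun n => (T₁.cell n ω : Set Plane)) ∂P := by
  obtain ⟨S, hS, hind, hindT, hT⟩ := h
  let X : Ω → ℕ → Closeds Plane := fun ω n => T₁.cell n ω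
  let Y : Ω → ℕ → Closeds Plane := fun ω n => (S n).edgeSet ω
  have hX : Measurable X := measurable_pi_lambda _ fun n => T₁.measurable_cell n
  have hY : Measurable Y := measurable_pi_lambda _ fun n => (S n).measurable_edgeSet
  let W : Set ((ℕ → Closeds Plane) × (ℕ → Closeds Plane)) :=
    (⋂ (m) (n) (_ : m ≠ n), {p | Disjoint ((p.1 m : Set Plane) ∩ p.1 n) C}) ∩
      ⋂ n, {p | Disjoint ((p.1 n : Set Plane) ∩ p.2 n) C}
  have hW : MeasurableSet W := by
    have h1 : ∀ n, Measurable fun p : (ℕ → Closeds Plane) × (ℕ → Closeds Plane) => p.1 n :=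
      fun n => (measurable_pi_apply n).comp measurable_fst
    have h2 : ∀ n, Measurable fun p : (ℕ → Closeds Plane) × (ℕ → Closeds Plane) => p.2 n :=
      fun n => (measurable_pi_apply n).comp measurable_snd
    exact (MeasurableSet.iInter fun m => MeasurableSet.iInter fun n => MeasurableSet.iInter fun _ =>
      measurableSet_disjoint_inter (h1 m) (h1 n) hC).inter
      (MeasurableSet.iInter fun n => measurableSet_disjoint_inter (h1 n) (h2 n) hC)
  have hmemW : ∀ ω ω', (X ω, Y ω') ∈ W ↔
      Disjoint (edges fun n => (T₁.cell n ω : Set Plane)) C ∧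
        ∀ n, Disjoint ((T₁.cell n ω : Set Plane) ∩ (S n).edgeSet ω') C := by
    intro ω ω'
    rw [(T₁.isTessellation ω).disjoint_edges_iff]
    simp only [W, Set.mem_inter_iff, Set.mem_iInter, Set.mem_ofPred_eq, X, Y]
  have hae : {ω | T.edgeSet ω ∈ missing C} =ᵐ[P] ((fun ω => (X ω, Y ω)) ⁻¹' W : Set Ω) := by
    refine eventuallyEq_set.2 (hT.mono fun ω hω => ?_)
    rw [Set.mem_ofPred_eq, mem_missing, hω, Set.mem_preimage, hmemW]
    simp only [edges, Set.disjoint_iUnion_left, Set.disjoint_union_left]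
    exact forall_and
  have hsec : ∀ ω, P.map Y (Prod.mk (X ω) ⁻¹' W) =
      ENNReal.ofReal (cellProd (T₂.void P') C fun n => (T₁.cell n ω : Set Plane)) := by
    intro ω
    rw [Measure.map_apply hY (measurable_prodMk_left hW)]
    by_cases hd : Disjoint (edges fun n => (T₁.cell n ω : Set Plane)) C
    · rw [← real_forall_disjoint hS hind hC (T₁.isTessellation ω) hd, ofReal_measureReal]
      congr 1
      ext ω'
      exact (hmemW ω ω').trans (and_iff_right hd)
    · have : Y ⁻¹' (Prod.mk (X ω) ⁻¹' W) = ∅ :=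
        Set.eq_empty_of_forall_notMem fun ω' hω' => hd ((hmemW ω ω').1 hω').1
      rw [this, cellProd_of_not_disjoint _ hd]
      simp
  have hlaw := (indepFun_iff_map_prod_eq_prod_map_map hX.aemeasurable hY.aemeasurable).1 hindT
  have hprob : IsProbabilityMeasure (P.map Y) := Measure.isProbabilityMeasure_map hY.aemeasurable
  rw [measureReal_congr hae, measureReal_def, ← Measure.map_apply (hX.prodMk hY) hW, hlaw,
    Measure.prod_apply hW, lintegral_map (measurable_measure_prodMk_left hW) hX]
  simp only [hsec]
  rw [← integral_toReal]
  · refine integral_congr_ae (ae_of_all _ fun ω => ENNReal.toReal_ofReal ?_)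
    exact cellProd_nonneg (fun _ => measureReal_nonneg) _ _
  · simp only [← hsec]
    exact ((measurable_measure_prodMk_left hW).comp hX).aemeasurable
  · exact ae_of_all _ fun _ => ENNReal.ofReal_lt_top

theorem IsNesting.isMixing [IsProbabilityMeasure P] [IsProbabilityMeasure P']
    {T T₁ : RandomTessellation Ω} {T₂ : RandomTessellation Ω'}
    (h₁ : T₁.IsMixing P) (h₂ : T₂.IsStationary P') (h : IsNesting P P' T T₁ T₂) :
    T.IsMixing P := by
  set q := T₂.void P' with hq_def
  have hq : q ∅ = 1 := by simp [q, RandomTessellation.void, missing_empty]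
  have hq0 : ∀ K, 0 ≤ q K := fun _ => measureReal_nonneg
  have hq1 : ∀ K, q K ≤ 1 := fun _ => measureReal_le_one
  have hqx : ∀ x K, IsCompact K → q ((fun y => y + x) ⁻¹' K) = q K := fun x K hK =>
    h₂.real_missing x hK
  have hG : ∀ C, ∃ G : Closeds Plane → ℝ, IsCompact C → Measurable G ∧ (∀ F, 0 ≤ G F) ∧
      (∀ F, G F ≤ 1) ∧ ∀ Ξ, IsTessellation Ξ → ∀ F : Closeds Plane, (F : Set Plane) = edges Ξ →
        G F = cellProd q C Ξ := by
    intro C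
    by_cases hC : IsCompact C
    · obtain ⟨G, hG⟩ := exists_measurable_eq_cellProd hq hq0 hq1 hC
      exact ⟨G, fun _ => hG⟩
    · exact ⟨0, fun h => absurd h hC⟩
  choose G hG using hG
  have hZ := T₁.measurable_edgeSet
  have hcell : ∀ C, IsCompact C → ∀ ω,
      cellProd q C (fun n => (T₁.cell n ω : Set Plane)) = G C (T₁.edgeSet ω) := fun C hC ω =>
    ((hG C hC).2.2.2 _ (T₁.isTessellation ω) _ rfl).symm
  have key : ∀ C, IsCompact C →
      P.real {ω | T.edgeSet ω ∈ missing C} = ∫ ω, G C (T₁.edgeSet ω) ∂P := by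
    intro C hC
    rw [h.real_missing hC]
    simp only [← hq_def, hcell C hC]
  -- stationarity of the component tessellation moves the translation to the initial one
  have hGx : ∀ x C, IsCompact C → ∀ ω,
      G ((fun y => y + x) ⁻¹' C) (T₁.edgeSet ω) = G C (translate x (T₁.edgeSet ω)) := by
    intro x C hC ω
    rw [← hcell _ (isCompact_preimage_add hC x), cellProd_preimage_add (hqx x) hC
      (T₁.isTessellation ω)]
    refine ((hG C hC).2.2.2 _ ((T₁.isTessellation ω).translate x) _ ?_).symm
    rw [edges_translate]
    rfl
  refine RandomTessellation.isMixing_of_missing (fun x C hC => ?_) fun C C' hC hC' => ?_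
  · rw [key _ (isCompact_preimage_add hC x), key C hC]
    simp only [hGx x C hC]
    exact ((h₁.1 x).comp (hG C hC).1).integral_eq
  · obtain ⟨hm, h0, h1, -⟩ := hG C hC
    obtain ⟨hm', h0', h1', -⟩ := hG C' hC'
    have hlim := tendsto_integral_mul_translate hZ h₁.2 hm hm' h0 h1 h0' h1'
    have hZx : ∀ x, Measurable fun ω => translate x (T₁.edgeSet ω) := fun x =>
      (measurable_translate x).comp hZ
    -- the error made by treating the cells that meet `C` and those that meet `C' - x` separately
    have herr : Tendsto (fun x => ∫ ω, (G (C ∪ (fun y => y + x) ⁻¹' C') (T₁.edgeSet ω) -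
        G C (T₁.edgeSet ω) * G C' (translate x (T₁.edgeSet ω))) ∂P)
        (Bornology.cobounded Plane) (𝓝 (∫ _, (0 : ℝ) ∂P)) := by
      refine tendsto_integral_filter_of_dominated_convergence (fun _ => 1)
        (Eventually.of_forall fun x => ?_) (Eventually.of_forall fun x => ae_of_all _ fun ω => ?_)
        (integrable_const _) (ae_of_all _ fun ω => ?_)
      · have hmx := (hG _ (hC.union (isCompact_preimage_add hC' x))).1
        exact ((hmx.comp hZ).sub ((hm.comp hZ).mul (hm'.comp (hZx x)))).aestronglyMeasurable
      · obtain ⟨-, h0x, h1x, -⟩ := hG _ (hC.union (isCompact_preimage_add hC' x))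
        rw [Real.norm_eq_abs]
        exact abs_sub_le_of_nonneg_of_le (h0x _) (h1x _) (mul_nonneg (h0 _) (h0' _))
          (mul_le_one₀ (h1 _) (h0' _) (h1' _))
      · refine tendsto_const_nhds.congr' ?_
        filter_upwards [eventually_cellProd_union hq hC hC' (T₁.isTessellation ω)] with x hx
        rw [hcell _ (hC.union (isCompact_preimage_add hC' x)), hcell C hC,
          hcell _ (isCompact_preimage_add hC' x), hGx x C' hC'] at hx
        rw [hx, sub_self]
    have hsum := herr.add hlim
    rw [integral_zero, zero_add, ← key C hC, ← key C' hC'] at hsum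
    refine hsum.congr fun x => ?_
    have hCx := hC.union (isCompact_preimage_add hC' x)
    obtain ⟨hmx, h0x, h1x, -⟩ := hG _ hCx
    rw [key _ hCx, integral_sub, sub_add_cancel]
    · exact integrable_of_mem_Icc (hmx.comp hZ) (fun _ => h0x _) fun _ => h1x _
    · exact integrable_of_mem_Icc ((hm.comp hZ).mul (hm'.comp (hZx x)))
        (fun _ => mul_nonneg (h0 _) (h0' _)) fun _ => mul_le_one₀ (h1 _) (h0' _) (h1' _)

end

end RandTess

theorem lemma4 {Ω Ω' : Type*} [MeasurableSpace Ω] [MeasurableSpace Ω']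
    (P : MeasureTheory.Measure Ω) [MeasureTheory.IsProbabilityMeasure P]
    (P' : MeasureTheory.Measure Ω') [MeasureTheory.IsProbabilityMeasure P'] :
    (∀ T T₁ T₂ : RandTess.RandomTessellation Ω,
      T₁.IsMixing P → T₂.IsMixing P → RandTess.IsSuperposition P T T₁ T₂ → T.IsMixing P) ∧
    (∀ (T T₁ : RandTess.RandomTessellation Ω) (T₂ : RandTess.RandomTessellation Ω'),
      T₁.IsMixing P → T₂.IsStationary P' → RandTess.IsNesting P P' T T₁ T₂ → T.IsMixing P) :=
  ⟨fun _ _ _ h₁ h₂ h => RandTess.IsSuperposition.isMixing h₁ h₂ h,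
    fun _ _ _ h₁ h₂ h => RandTess.IsNesting.isMixing h₁ h₂ h⟩
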